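/- Let $n\ge 0$ and let $\pi\in\mathcal S_n$ be an involution, that is, $\pi\circ\pi=\mathrm{id}$ (the identity is included). Let $P$ be the tableau corresponding to $\pi$ under the Robinson--Schensted--Knuth correspondence, that is, its insertion tableau, obtained from the empty tableau by successively row-inserting $\pi(1),\pi(2),\ldots,\pi(n)$. (For an involution it coincides with the recording tableau.) Then $$\operatorname{sign}(\pi)=(-1)^{e},$$ where $e$ is the total length of all even-indexed rows of $P$, that is, of its second, fourth, sixth, $\ldots$ rows, the rows being numbered $1,2,3,\ldots$ from the top. -/

import Mathlib

namespace RSK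

/-- Row insertion of `x` into a single increasing row: `x` replaces (bumps) the first entry larger
than `x`; if there is no such entry, `x` is placed at the end of the row. Returns the new row
together with the bumped entry, if any. -/
def rowInsert {α : Type*} [LinearOrder α] (x : α) : List α → List α × Option α
  | [] => ([x], none)
  | y :: ys => if x < y then (x :: ys, some y) else (y :: (rowInsert x ys).1, (rowInsert x ys).2)

/-- Schensted insertion of `x` into a tableau, given as the list of its rows from top to bottom:
`x` is row-inserted into the first row, the bumped entry (if any) is inserted in the same way into
the tableau formed by the rows below, and so on, until nothing is bumped. -/
def tableauInsert {α : Type*} [LinearOrder α] (x : α) : List (List α) → List (List α)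
  | [] => [[x]]
  | r :: rs =>
    match rowInsert x r with
    | (r', none) => r' :: rs
    | (r', some y) => r' :: tableauInsert y rs

/-- The insertion tableau of a permutation `π` under the Robinson-Schensted(-Knuth) correspondence:
the letters of the word `π 0, π 1, …, π (n - 1)` are inserted from left to right, starting with the
empty tableau. The letters are the elements of `Fin n` in place of `1, …, n`. -/
def insertionTableau {n : ℕ} (π : Equiv.Perm (Fin n)) : List (List (Fin n)) :=
  (List.ofFn π).foldl (fun T x => tableauInsert x T) []

/-- The total length of the rows of `T` with even index, the rows being numbered `1, 2, 3, …` from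
the top; so the list position `i` holds row number `i + 1`. -/
def evenRowsLength {α : Type*} (T : List (List α)) : ℕ :=
  ∑ i ∈ Finset.univ.filter (fun i : Fin T.length => Even ((i : ℕ) + 1)), (T.get i).length

end RSK

/-! Both sides count 2-cycles: the sign is (-1) to their number, and that number equals e. To see
the latter, let the shape at (i, j) be that of the insertion tableau of the letters `< j` among the
first i. These shapes form Fomin's growth diagram: the shape at (i+1, j+1) is determined by the
other three corners of its square and by whether σ i = j (`localRule_partialTableau`,
`LocalRule.unique`). The rule is symmetric, so the diagram of an involution is symmetric about the
diagonal. In a diagonal square the two side corners then agree: a fixed point adds a cell to row 1,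
σ i < i adds cells to two consecutive rows, and σ i > i changes nothing. Hence e grows by one
exactly when σ i < i, once per 2-cycle. -/

namespace RSK

/-! ### Shapes, and insertion in the presence of a maximal entry -/

section Tableau

variable {α : Type*}

/-- Append the entry `m` to the end of the row at list position `k`, padding with empty rows. -/
def appendAt (m : α) : ℕ → List (List α) → List (List α)
  | 0, [] => [[m]]
  | 0, r :: rs => (r ++ [m]) :: rs
  | k + 1, [] => [] :: appendAt m k []
  | k + 1, r :: rs => r :: appendAt m k rs

/-- The sequence of row lengths. -/
def shape (T : List (List α)) (i : ℕ) : ℕ := (T.getD i []).length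

@[simp] lemma shape_nil (i : ℕ) : shape ([] : List (List α)) i = 0 := by simp [shape]

@[simp] lemma shape_cons_zero (r : List α) (rs : List (List α)) :
    shape (r :: rs) 0 = r.length := by simp [shape]

@[simp] lemma shape_cons_succ (r : List α) (rs : List (List α)) (i : ℕ) :
    shape (r :: rs) (i + 1) = shape rs i := by simp [shape]

lemma shape_eq_zero {T : List (List α)} {i : ℕ} (h : T.length ≤ i) : shape T i = 0 := by
  simp [shape, List.getElem?_eq_none h]

lemma shape_appendAt (m : α) (k : ℕ) (T : List (List α)) :
    shape (appendAt m k T) = shape T + Pi.single k 1 := by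
  induction k generalizing T with
  | zero => cases T <;> ext i <;> cases i <;> simp [appendAt]
  | succ k ih =>
    cases T with
    | nil => ext i; cases i <;> simp [appendAt, ih, Pi.single_apply]
    | cons r rs => ext i; cases i <;> simp [appendAt, ih, Pi.single_apply]

/-- A common bound `N` allows tableaux with different numbers of rows to be compared termwise. -/
lemma evenRowsLength_eq_sum_range {T : List (List α)} {N : ℕ} (h : T.length ≤ N) :
    evenRowsLength T = ∑ i ∈ Finset.range N, if Even (i + 1) then shape T i else 0 := by
  have h₁ : evenRowsLength T =
      ∑ i ∈ Finset.range T.length, if Even (i + 1) then shape T i else 0 := by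
    rw [evenRowsLength, Finset.sum_filter, Finset.sum_range]
    refine Finset.sum_congr rfl fun i _ => ?_
    simp [shape]
  rw [h₁]
  refine Finset.sum_subset (Finset.range_mono h) fun i _ hi => ?_
  rw [shape_eq_zero (by simpa using hi), ite_self]

lemma evenRowsLength_congr {T T' : List (List α)} (h : shape T = shape T') :
    evenRowsLength T = evenRowsLength T' := by
  rw [evenRowsLength_eq_sum_range (le_max_left _ T'.length),
    evenRowsLength_eq_sum_range (le_max_right T.length _), h]

lemma evenRowsLength_of_shape_eq_add_single {T T' : List (List α)} {k : ℕ}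
    (h : shape T' = shape T + Pi.single k 1) :
    evenRowsLength T' = evenRowsLength T + if Even (k + 1) then 1 else 0 := by
  have hT : T.length ≤ T.length + T'.length + k + 1 := by omega
  have hT' : T'.length ≤ T.length + T'.length + k + 1 := by omega
  have hk : k ∈ Finset.range (T.length + T'.length + k + 1) := Finset.mem_range.2 (by omega)
  rw [evenRowsLength_eq_sum_range hT, evenRowsLength_eq_sum_range hT', h,
    ← Finset.sum_ite_eq_of_mem' _ k (fun i => if Even (i + 1) then 1 else 0) hk,
    ← Finset.sum_add_distrib]
  refine Finset.sum_congr rfl fun i _ => ?_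
  rcases eq_or_ne i k with rfl | hi
  · by_cases he : Even (i + 1) <;> simp [he, -Nat.not_even_iff_odd]
  · simp [hi]

/-- Exactly one of two consecutive rows has even index. The letter `m` only serves to realize the
intermediate shape by some array. -/
lemma evenRowsLength_of_shape_eq_add_two {T T' : List (List α)} (m : α) {k : ℕ}
    (h : shape T' = shape T + Pi.single k 1 + Pi.single (k + 1) 1) :
    evenRowsLength T' = evenRowsLength T + 1 := by
  rw [← shape_appendAt m] at h
  rw [evenRowsLength_of_shape_eq_add_single h,
    evenRowsLength_of_shape_eq_add_single (shape_appendAt m k T)]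
  by_cases hk : Even (k + 1) <;> simp [Nat.even_add_one, hk]

variable [LinearOrder α]

/-- The list position of the row in which the insertion of `x` into `T` creates a new cell. -/
def newCellRow (x : α) : List (List α) → ℕ
  | [] => 0
  | r :: rs =>
    match (rowInsert x r).2 with
    | none => 0
    | some y => newCellRow y rs + 1

lemma tableauInsert_cons_of_none {x : α} {r : List α} (h : (rowInsert x r).2 = none)
    (rs : List (List α)) : tableauInsert x (r :: rs) = (rowInsert x r).1 :: rs := by
  rw [tableauInsert]; split <;> simp_all

lemma tableauInsert_cons_of_some {x y : α} {r : List α} (h : (rowInsert x r).2 = some y)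
    (rs : List (List α)) :
    tableauInsert x (r :: rs) = (rowInsert x r).1 :: tableauInsert y rs := by
  rw [tableauInsert]; split <;> simp_all

lemma length_rowInsert (x : α) (r : List α) :
    (rowInsert x r).1.length = r.length + if (rowInsert x r).2 = none then 1 else 0 := by
  induction r with
  | nil => simp [rowInsert]
  | cons y ys ih =>
    rw [rowInsert]
    split_ifs <;> simp_all

lemma shape_tableauInsert (x : α) (T : List (List α)) :
    shape (tableauInsert x T) = shape T + Pi.single (newCellRow x T) 1 := by
  induction T generalizing x with
  | nil => ext i; cases i <;> simp [tableauInsert, newCellRow]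
  | cons r rs ih =>
    cases h : (rowInsert x r).2 with
    | none =>
      rw [tableauInsert_cons_of_none h]
      ext i
      cases i <;> simp [newCellRow, h, length_rowInsert]
    | some y =>
      rw [tableauInsert_cons_of_some h]
      ext i
      cases i <;> simp [newCellRow, h, length_rowInsert, Pi.single_apply, ih]

lemma mem_rowInsert_fst {x z : α} {r : List α} (h : z ∈ (rowInsert x r).1) : z = x ∨ z ∈ r := by
  induction r with
  | nil => simpa [rowInsert] using h
  | cons y ys ih =>
    rw [rowInsert] at h
    split_ifs at h <;> simp_all <;> tauto

lemma mem_of_rowInsert_snd {x y : α} {r : List α} (h : (rowInsert x r).2 = some y) : y ∈ r := by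
  induction r with
  | nil => simp [rowInsert] at h
  | cons z zs ih =>
    rw [rowInsert] at h
    split_ifs at h <;> simp_all

lemma rowInsert_of_forall_lt {m : α} {r : List α} (h : ∀ y ∈ r, y < m) :
    rowInsert m r = (r ++ [m], none) := by
  induction r with
  | nil => simp [rowInsert]
  | cons y ys ih =>
    simp only [List.mem_cons, forall_eq_or_imp] at h
    simp [rowInsert, h.1.le, ih h.2]

lemma rowInsert_append_of_some {x y m : α} {r : List α} (h : (rowInsert x r).2 = some y) :
    rowInsert x (r ++ [m]) = ((rowInsert x r).1 ++ [m], some y) := by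
  induction r with
  | nil => simp [rowInsert] at h
  | cons z zs ih =>
    rw [List.cons_append, rowInsert, rowInsert]
    rw [rowInsert] at h
    split_ifs at h ⊢ <;> simp_all

lemma rowInsert_append_of_none {x m : α} {r : List α} (hx : x < m)
    (h : (rowInsert x r).2 = none) :
    rowInsert x (r ++ [m]) = ((rowInsert x r).1, some m) := by
  induction r with
  | nil => simp [rowInsert, hx]
  | cons z zs ih =>
    rw [List.cons_append, rowInsert, rowInsert]
    rw [rowInsert] at h
    split_ifs at h ⊢
    simp_all

/-- All entries of `T` are smaller than `m`. -/
def EntriesLT (T : List (List α)) (m : α) : Prop := ∀ r ∈ T, ∀ y ∈ r, y < m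

lemma EntriesLT.tableauInsert {x m : α} {T : List (List α)} (hT : EntriesLT T m) (hx : x < m) :
    EntriesLT (tableauInsert x T) m := by
  induction T generalizing x with
  | nil => simpa [EntriesLT, RSK.tableauInsert] using hx
  | cons r rs ih =>
    simp only [EntriesLT, List.mem_cons, forall_eq_or_imp] at hT
    have h₁ : ∀ y ∈ (rowInsert x r).1, y < m := fun y hy => by
      rcases mem_rowInsert_fst hy with rfl | hy
      exacts [hx, hT.1 y hy]
    cases h : (rowInsert x r).2 with
    | none =>
      rw [tableauInsert_cons_of_none h]
      simp only [EntriesLT, List.mem_cons, forall_eq_or_imp]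
      exact ⟨h₁, hT.2⟩
    | some y =>
      rw [tableauInsert_cons_of_some h]
      simp only [EntriesLT, List.mem_cons, forall_eq_or_imp]
      exact ⟨h₁, ih hT.2 (hT.1 y (mem_of_rowInsert_snd h))⟩

lemma tableauInsert_of_entriesLT {m : α} {T : List (List α)} (hT : EntriesLT T m) :
    tableauInsert m T = appendAt m 0 T := by
  cases T with
  | nil => rfl
  | cons r rs =>
    simp only [EntriesLT, List.mem_cons, forall_eq_or_imp] at hT
    have h := rowInsert_of_forall_lt hT.1
    rw [tableauInsert_cons_of_none (by rw [h]), h, appendAt]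

/-- Inserting `x` into a tableau with a maximal entry `m` at the end of a row: the entry `m` stays
in place, unless the new cell is the one occupied by `m`; then `m` moves to the next row. -/
lemma tableauInsert_appendAt {x m : α} {T : List (List α)} (hT : EntriesLT T m) (hx : x < m)
    (k : ℕ) :
    tableauInsert x (appendAt m k T) =
      appendAt m (if newCellRow x T = k then k + 1 else k) (tableauInsert x T) := by
  induction T generalizing x k with
  | nil =>
    cases k with
    | zero => simp [tableauInsert, appendAt, rowInsert, hx, newCellRow]
    | succ k => simp [tableauInsert, appendAt, rowInsert, newCellRow]
  | cons r rs ih =>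
    simp only [EntriesLT, List.mem_cons, forall_eq_or_imp] at hT
    cases h : (rowInsert x r).2 with
    | none =>
      rw [tableauInsert_cons_of_none h]
      cases k with
      | zero =>
        have h₁ := rowInsert_append_of_none hx h
        rw [appendAt, tableauInsert_cons_of_some (by rw [h₁]), h₁,
          tableauInsert_of_entriesLT hT.2]
        simp [newCellRow, h, appendAt]
      | succ k =>
        rw [appendAt, tableauInsert_cons_of_none h]
        simp [newCellRow, h, appendAt]
    | some y =>
      rw [tableauInsert_cons_of_some h]
      cases k with
      | zero =>
        have h₁ := rowInsert_append_of_some (m := m) h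
        rw [appendAt, tableauInsert_cons_of_some (by rw [h₁]), h₁]
        simp [newCellRow, h, appendAt]
      | succ k =>
        rw [appendAt, tableauInsert_cons_of_some h, ih hT.2 (hT.1 y (mem_of_rowInsert_snd h))]
        simp only [newCellRow, h, Nat.add_right_cancel_iff]
        split_ifs <;> rfl

end Tableau

/-! ### Growth diagrams and the local rule -/

section Growth

/-- Fomin's local growth rule for shapes; `b` says whether the square contains a point. -/
inductive LocalRule (b : Prop) (ρ l μ ν : ℕ → ℕ) : Prop
  | point (hb : b) (hl : l = ρ) (hμ : μ = ρ) (hν : ν = ρ + Pi.single 0 1)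
  | left (hb : ¬b) (hl : l = ρ) (hν : ν = μ)
  | right (hb : ¬b) (hμ : μ = ρ) (hν : ν = l)
  | distinct (hb : ¬b) (s r : ℕ) (hsr : s ≠ r) (hl : l = ρ + Pi.single s 1)
      (hμ : μ = ρ + Pi.single r 1) (hν : ν = ρ + Pi.single s 1 + Pi.single r 1)
  | bump (hb : ¬b) (s : ℕ) (hl : l = ρ + Pi.single s 1)
      (hμ : μ = ρ + Pi.single s 1) (hν : ν = ρ + Pi.single s 1 + Pi.single (s + 1) 1)

lemma LocalRule.symm {b : Prop} {ρ l μ ν : ℕ → ℕ} (h : LocalRule b ρ l μ ν) :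
    LocalRule b ρ μ l ν := by
  cases h with
  | point hb hl hμ hν => exact .point hb hμ hl hν
  | left hb hl hν => exact .right hb hl hν
  | right hb hμ hν => exact .left hb hμ hν
  | distinct hb s r hsr hl hμ hν =>
    exact .distinct hb r s hsr.symm hμ hl (by rw [hν, add_right_comm])
  | bump hb s hl hμ hν => exact .bump hb s hμ hl hν

lemma single_one_injective : Function.Injective fun k : ℕ => (Pi.single k 1 : ℕ → ℕ) := by
  intro s r h
  by_contra hsr
  have := congrFun h s
  simp [hsr] at this

lemma add_single_one_ne_self (ρ : ℕ → ℕ) (k : ℕ) : ρ + Pi.single k 1 ≠ ρ := by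
  simp

/-- Where several cases apply, as when all three known corners agree and `b` fails, they give the
same `ν`. -/
lemma LocalRule.unique {b : Prop} {ρ l μ ν ν' : ℕ → ℕ} (h : LocalRule b ρ l μ ν)
    (h' : LocalRule b ρ l μ ν') : ν = ν' := by
  have inj : ∀ s r : ℕ, (Pi.single s 1 : ℕ → ℕ) = Pi.single r 1 → s = r :=
    fun s r e => single_one_injective e
  cases h <;> cases h' <;> subst_vars <;> simp_all
  all_goals grind

variable {n : ℕ}

/-- The insertion tableau of the first `i` letters of `σ`, the letters `≥ j` being left out. -/
def partialTableau (σ : Equiv.Perm (Fin n)) (i j : ℕ) : List (List (Fin n)) :=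
  (((List.ofFn σ).take i).filter fun x : Fin n => (x : ℕ) < j).foldl (fun T x => tableauInsert x T) []

variable (σ : Equiv.Perm (Fin n))

@[simp] lemma partialTableau_zero_left (j : ℕ) : partialTableau σ 0 j = [] := by
  simp [partialTableau]

@[simp] lemma partialTableau_zero_right (i : ℕ) : partialTableau σ i 0 = [] := by
  simp [partialTableau]

lemma partialTableau_self : partialTableau σ n n = insertionTableau σ := by
  simp [partialTableau, insertionTableau, List.take_of_length_le]

lemma partialTableau_succ_left (i : Fin n) (j : ℕ) :
    partialTableau σ (i + 1) j =
      if (σ i : ℕ) < j then tableauInsert (σ i) (partialTableau σ i j)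
      else partialTableau σ i j := by
  have hi : (i : ℕ) < (List.ofFn σ).length := by simp
  rw [partialTableau, partialTableau, ← List.take_concat_get' _ _ hi]
  split_ifs with h <;> simp [List.filter_append, h]

lemma entriesLT_partialTableau {i : ℕ} (hi : i ≤ n) (j : Fin n) :
    EntriesLT (partialTableau σ i j) j := by
  induction i with
  | zero => simp [EntriesLT]
  | succ i ih =>
    rw [partialTableau_succ_left σ ⟨i, hi⟩]
    split_ifs with h
    · exact (ih (by omega)).tableauInsert h
    · exact ih (by omega)

/-- The letter `j` has not yet been read. -/
lemma partialTableau_succ_right_of_le {i : ℕ} (hi : i ≤ n) {j : Fin n}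
    (h : i ≤ (σ.symm j : ℕ)) : partialTableau σ i (j + 1) = partialTableau σ i j := by
  induction i with
  | zero => simp
  | succ i ih =>
    rw [partialTableau_succ_left σ ⟨i, hi⟩, partialTableau_succ_left σ ⟨i, hi⟩,
      ih (by omega) (by omega)]
    have hne : (σ ⟨i, hi⟩ : ℕ) ≠ j := by
      intro he
      rw [← Fin.ext he] at h
      simp at h
    simp only [show (σ ⟨i, hi⟩ : ℕ) < j + 1 ↔ (σ ⟨i, hi⟩ : ℕ) < j by omega]

/-- Once read, the maximal letter `j` always sits at the end of a row and never affects the smaller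
letters. -/
lemma exists_partialTableau_succ_right {i : ℕ} (hi : i ≤ n) {j : Fin n}
    (h : (σ.symm j : ℕ) < i) :
    ∃ k, partialTableau σ i (j + 1) = appendAt j k (partialTableau σ i j) := by
  induction i with
  | zero => omega
  | succ i ih =>
    rw [partialTableau_succ_left σ ⟨i, hi⟩, partialTableau_succ_left σ ⟨i, hi⟩]
    have hlt := entriesLT_partialTableau σ (i := i) (by omega) j
    rcases eq_or_lt_of_le (Nat.lt_succ_iff.1 h) with h | h
    · have hij : σ ⟨i, hi⟩ = j := by
        rw [show (⟨i, hi⟩ : Fin n) = σ.symm j from Fin.ext h.symm, Equiv.apply_symm_apply]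
      rw [partialTableau_succ_right_of_le σ (by omega) h.ge, hij]
      exact ⟨0, by simp [tableauInsert_of_entriesLT hlt]⟩
    · obtain ⟨k, hk⟩ := ih (by omega) h
      have hne : (σ ⟨i, hi⟩ : ℕ) ≠ j := by
        intro he
        rw [← Fin.ext he] at h
        simp at h
      simp only [show (σ ⟨i, hi⟩ : ℕ) < j + 1 ↔ (σ ⟨i, hi⟩ : ℕ) < j by omega, hk]
      split_ifs with hx
      · exact ⟨_, tableauInsert_appendAt hlt hx k⟩
      · exact ⟨k, rfl⟩

lemma localRule_partialTableau (i j : Fin n) :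
    LocalRule (σ i = j) (shape (partialTableau σ i j)) (shape (partialTableau σ (i + 1) j))
      (shape (partialTableau σ i (j + 1))) (shape (partialTableau σ (i + 1) (j + 1))) := by
  have hlt := entriesLT_partialTableau σ i.2.le j
  rw [partialTableau_succ_left, partialTableau_succ_left]
  rcases lt_trichotomy (σ i) j with h | h | h
  · have h₁ : (σ i : ℕ) < j := h
    rw [if_pos h₁, if_pos (by omega)]
    rcases lt_or_ge (σ.symm j) i with hi | hi
    · obtain ⟨k, hk⟩ := exists_partialTableau_succ_right σ i.2.le hi
      rw [hk, tableauInsert_appendAt hlt h]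
      simp only [shape_appendAt, shape_tableauInsert]
      -- Either the new cell is the one held by `j`, which is pushed down a row, or `j` stays.
      split_ifs with hs
      · subst hs
        exact .bump h.ne _ rfl rfl rfl
      · exact .distinct h.ne _ _ hs rfl rfl rfl
    · rw [partialTableau_succ_right_of_le σ i.2.le hi]
      exact .right h.ne rfl rfl
  · have hi : (i : ℕ) ≤ (σ.symm j : ℕ) := by rw [← h]; simp
    rw [partialTableau_succ_right_of_le σ i.2.le hi, h, if_neg (lt_irrefl _),
      if_pos (Nat.lt_succ_self _), tableauInsert_of_entriesLT hlt, shape_appendAt]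
    exact .point rfl rfl rfl rfl
  · have h₁ : (j : ℕ) < σ i := h
    rw [if_neg (by omega), if_neg (by omega)]
    exact .left h.ne' rfl rfl

/-- The symmetry of the Robinson-Schensted correspondence, on the level of shapes. -/
lemma shape_partialTableau_symm {i j : ℕ} (hi : i ≤ n) (hj : j ≤ n) :
    shape (partialTableau σ.symm j i) = shape (partialTableau σ i j) := by
  induction i generalizing j with
  | zero => simp
  | succ i ihi =>
    induction j with
    | zero => simp
    | succ j ihj =>
      have h := localRule_partialTableau σ ⟨i, hi⟩ ⟨j, hj⟩
      -- The square of the inverse, reflected in the diagonal; three corners agree by induction.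
      have h' := (localRule_partialTableau σ.symm ⟨j, hj⟩ ⟨i, hi⟩).symm
      simp only [Equiv.symm_apply_eq, ihi (by omega : i ≤ n) (by omega : j ≤ n),
        ihi (by omega : i ≤ n) hj, ihj (by omega)] at h'
      rw [eq_comm] at h'
      exact h'.unique h

/-! ### Involutions: diagonal squares and the sign -/

variable {σ}

lemma evenRowsLength_partialTableau_succ (hσ : Function.Involutive σ) (i : Fin n) :
    evenRowsLength (partialTableau σ (i + 1) (i + 1)) =
      evenRowsLength (partialTableau σ i i) + if σ i < i then 1 else 0 := by
  have hs : σ.symm = σ := Equiv.ext fun x => by rw [Equiv.symm_apply_eq, hσ x]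
  have hsymm : shape (partialTableau σ i (i + 1)) = shape (partialTableau σ (i + 1) i) := by
    conv_lhs => rw [← hs]
    exact shape_partialTableau_symm σ (by omega) (by omega)
  have h := localRule_partialTableau σ i i
  rw [hsymm] at h
  rcases lt_trichotomy (σ i) i with hi | hi | hi
  · rw [if_pos hi]
    -- The side corners agree and differ from `ρ`, so only `bump` survives.
    have hl : shape (partialTableau σ (i + 1) i) ≠ shape (partialTableau σ i i) := by
      rw [partialTableau_succ_left, if_pos (by exact hi), shape_tableauInsert]
      exact add_single_one_ne_self _ _
    cases h with
    | point hb => exact absurd hb hi.ne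
    | left _ h => exact absurd h hl
    | right _ h => exact absurd h hl
    | distinct _ s r hsr h₁ h₂ =>
      exact absurd (single_one_injective (add_left_cancel (h₁.symm.trans h₂))) hsr
    | bump _ s _ _ hν => exact evenRowsLength_of_shape_eq_add_two i hν
  · cases h with
    | point _ _ _ hν => simp [evenRowsLength_of_shape_eq_add_single hν, hi]
    | _ hb => exact absurd hi hb
  · have hi' : (i : ℕ) < σ i := hi
    rw [if_neg hi.not_gt, partialTableau_succ_left, if_neg (by omega),
      partialTableau_succ_right_of_le σ i.2.le (by rw [hs]; exact hi'.le), add_zero]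

lemma evenRowsLength_insertionTableau (hσ : Function.Involutive σ) :
    evenRowsLength (insertionTableau σ) = (Finset.univ.filter fun i => σ i < i).card := by
  have h : ∀ i ≤ n, evenRowsLength (partialTableau σ i i) =
      (Finset.univ.filter fun k : Fin n => (k : ℕ) < i ∧ σ k < k).card := by
    intro i hi
    induction i with
    | zero => rw [partialTableau_zero_left]; simp [evenRowsLength]
    | succ i ih =>
      rw [evenRowsLength_partialTableau_succ hσ ⟨i, hi⟩, ih (by omega)]
      have hsplit : (Finset.univ.filter fun k : Fin n => (k : ℕ) < i + 1 ∧ σ k < k) =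
          (Finset.univ.filter fun k : Fin n => (k : ℕ) < i ∧ σ k < k) ∪
            ({⟨i, hi⟩} : Finset (Fin n)).filter fun k => σ k < k := by
        ext k
        simp only [Finset.mem_filter, Finset.mem_univ, true_and, Finset.mem_union,
          Finset.mem_singleton, Fin.ext_iff]
        rw [Nat.lt_succ_iff_lt_or_eq, or_and_right]
      rw [hsplit, Finset.card_union_of_disjoint, Finset.filter_singleton]
      · split_ifs <;> simp
      · rw [Finset.disjoint_left]
        intro k hk hk'
        simp only [Finset.mem_filter, Finset.mem_singleton] at hk hk'
        rw [hk'.1] at hk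
        exact lt_irrefl _ hk.2.1
  rw [← partialTableau_self, h n le_rfl]
  simp

lemma sign_of_involutive (hσ : Function.Involutive σ) :
    Equiv.Perm.sign σ = (-1) ^ (Finset.univ.filter fun i => σ i < i).card := by
  have hsq : σ ^ 2 = 1 := Equiv.ext fun x => by simp [pow_two, hσ x]
  -- `σ` exchanges the smaller and larger elements of each 2-cycle, so the support has twice as many
  -- elements as there are 2-cycles.
  have hcard : (Finset.univ.filter fun i => i < σ i).card =
      (Finset.univ.filter fun i => σ i < i).card :=
    Finset.card_equiv σ fun i => by simp [hσ i]
  have hsupp : σ.support =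
      (Finset.univ.filter fun i => i < σ i) ∪ Finset.univ.filter fun i => σ i < i := by
    ext i
    rw [Equiv.Perm.mem_support, ne_iff_lt_or_gt, or_comm]
    simp
  have hdisj : Disjoint (Finset.univ.filter fun i => i < σ i)
      (Finset.univ.filter fun i => σ i < i) := by
    rw [Finset.disjoint_filter]
    exact fun i _ h => h.not_gt
  rw [Equiv.Perm.sign_of_pow_two_eq_one hsq, σ.card_fixedPoints,
    Nat.sub_sub_self σ.sum_cycleType_le, σ.sum_cycleType, hsupp,
    Finset.card_union_of_disjoint hdisj, hcard,
    ← two_mul, Nat.mul_div_cancel_left _ two_pos]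

end Growth

end RSK

theorem theorem3p1 (n : ℕ) (π : Equiv.Perm (Fin n)) (hπ : Function.Involutive π) :
    Equiv.Perm.sign π = (-1) ^ RSK.evenRowsLength (RSK.insertionTableau π) := by
  rw [RSK.evenRowsLength_insertionTableau hπ, RSK.sign_of_involutive hπ]
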